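/- Let $G$ be a simple even plane triangulation, that is, a finite simple graph drawn in the plane without crossings so that every face (including the outer one) is bounded by a triangle, and in which every vertex has even degree. Let $V_1, V_2, V_3$ be the colour classes of a proper $3$-colouring of the vertices of $G$. Call a vertex big if its degree in $G$ is at least $6$, and let $B_i$ be the set of big vertices in $V_i$, $i = 1, 2, 3$. Let $X$ and $Y$ be disjoint sets of big vertices of $G$ such that $B_1 \subseteq X$, $B_2 \subseteq Y$ and $B_3 \subseteq X \cup Y$. If the induced subgraphs $G[X]$ and $G[Y]$ are acyclic, then the vertex set of $G$ can be partitioned into two subsets $S$ and $T$ such that each of the induced subgraphs $G[S]$ and $G[T]$ is a tree. -/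

import Mathlib

/-- A rotation system (combinatorial embedding) of a simple graph `G`: a permutation of the darts
(oriented edges) of `G` that permutes the darts leaving each vertex in a single cycle, namely the
cyclic order in which the edges leave that vertex in the drawing. -/
structure RotationSystem {V : Type*} (G : SimpleGraph V) where
  /-- The next dart around the initial vertex. -/
  rot : Equiv.Perm G.Dart
  /-- `rot` keeps the initial vertex. -/
  rot_fst : ∀ d : G.Dart, (rot d).fst = d.fst
  /-- The darts leaving a vertex form one cycle of `rot`. -/
  rot_sameCycle : ∀ d e : G.Dart, d.fst = e.fst → rot.SameCycle d e

namespace RotationSystem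

variable {V : Type*} {G : SimpleGraph V}

/-- The permutation of the darts that walks along the face boundaries: traverse the dart `u → v`
and leave `v` along the dart that follows `v → u` in the rotation at `v`. -/
def facePerm (M : RotationSystem G) : Equiv.Perm G.Dart :=
  (Function.Involutive.toPerm SimpleGraph.Dart.symm SimpleGraph.Dart.symm_involutive).trans M.rot

/-- The faces of the embedding are the cycles of the face permutation (fixed points included). -/
def Face (M : RotationSystem G) : Type _ :=
  Quotient (Equiv.Perm.SameCycle.setoid M.facePerm)

/-- The embedding is a plane triangulation: the graph is connected, the surface that carries the
embedding is the sphere (Euler's formula `|V| - |E| + |F| = 2`), and every face is bounded by a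
triangle. As `G` has no loops, `face_triangle` says that every cycle of the face permutation
consists of exactly three darts `u → v`, `v → w`, `w → u`. (The one-vertex graph, which has no
darts, does not satisfy `euler`.) -/
structure IsPlaneTriangulation (M : RotationSystem G) : Prop where
  connected : G.Connected
  euler : Nat.card V + Nat.card M.Face = Nat.card G.edgeSet + 2
  face_triangle : ∀ d : G.Dart, M.facePerm (M.facePerm (M.facePerm d)) = d

end RotationSystem

/-- The set of big vertices, those of degree at least six. -/
def bigVertices {V : Type*} [Fintype V] (G : SimpleGraph V) [DecidableRel G.Adj] : Set V :=
  {v | 6 ≤ G.degree v}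

/-- The set of big vertices in the colour class `i` of a `3`-colouring. -/
def bigClass {V : Type*} [Fintype V] (G : SimpleGraph V) [DecidableRel G.Adj]
    (c : G.Coloring (Fin 3)) (i : Fin 3) : Set V :=
  {v | c v = i ∧ v ∈ bigVertices G}

/-!
The two parts need only be induced forests: in a plane triangulation every triangle has a side
inside one of two complementary parts, so at least `|V| - 2` edges lie inside the parts, and two
forests with that many edges are trees (`IsPlaneTriangulation.isTree_of_isAcyclic`).

So it suffices to add the small vertices (those of degree less than six) to the forests `G[X]` and
`G[Y]` one at a time. A vertex is blocked only if it has two neighbours joined in the first forest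
and two others joined in the second. For a small vertex these are all its neighbours, and their two
other colours alternate around it. If the two neighbours in one forest have the same colour, they
are opposite, and their path would cross the path in the other forest
(`IsPlaneTriangulation.color_ne_of_linked`). Otherwise each forest contains one neighbour of each of
the two colours.

The order of insertion excludes the second case. The small vertices of colour `0` come first, and go
to the first forest whenever possible. At that time only big neighbours of colours `1` and `2` are
present, and those of colour `1` lie in the second forest. Hence no such vertex is blocked, and if
it has to go to the second forest, all its neighbours of colour `2` are big and lie in `X`. When a
later vertex `v` is blocked in the second way, its neighbour `y` of colour `0` in the second forest
is of this kind. If `v` has colour `2`, then `v` itself would lie in `X`; if `v` has colour `1`, its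
neighbour of colour `2` in the second forest is adjacent to `y` and would lie in `X`.

That paths do not cross (`IsPlaneTriangulation.not_linked_of_linked`) is the combinatorial Jordan
curve theorem, in the form that the first homology of the sphere modulo two vanishes
(`IsPlaneTriangulation.exists_faceBoundary_eq`). It follows from Euler's formula by counting
dimensions.
-/

open SimpleGraph

/-! ### Walks inside a set of vertices -/

/-- The vertices `x` and `y` are joined by a walk of `G` all of whose vertices lie in `S`. -/
def SimpleGraph.Linked {V : Type*} (G : SimpleGraph V) (S : Set V) (x y : V) : Prop :=
  ∃ p : G.Walk x y, ∀ z ∈ p.support, z ∈ S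

namespace RotationSystem

variable {V : Type*} {G : SimpleGraph V} (M : RotationSystem G)

/-! ### Rotations -/

lemma facePerm_apply (d : G.Dart) : M.facePerm d = M.rot d.symm := rfl

lemma rot_symm_fst (d : G.Dart) : (M.rot.symm d).fst = d.fst := by
  rw [← M.rot_fst, Equiv.apply_symm_apply]

/-- A property that is passed on by the rotation spreads to all darts leaving the same vertex. -/
lemma rot_induction [Finite G.Dart] {P : G.Dart → Prop} {d e : G.Dart} (h : d.fst = e.fst)
    (hd : P d) (hP : ∀ x, x.fst = d.fst → P x → P (M.rot x)) : P e := by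
  obtain ⟨n, -, rfl⟩ := (M.rot_sameCycle d e h).exists_nat_pow_eq
  suffices ((M.rot ^ n) d).fst = d.fst ∧ P ((M.rot ^ n) d) from this.2
  clear h
  induction n with
  | zero => exact ⟨rfl, hd⟩
  | succ n ih =>
    rw [pow_succ', Equiv.Perm.mul_apply]
    exact ⟨(M.rot_fst _).trans ih.1, hP _ ih.1 ih.2⟩

/-- Neighbours that are consecutive in the rotation at a vertex are adjacent. -/
lemma IsPlaneTriangulation.adj_rot_snd {M : RotationSystem G} (hM : M.IsPlaneTriangulation)
    (d : G.Dart) : G.Adj (M.rot d).snd d.snd := by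
  have h := hM.face_triangle d.symm
  simp only [facePerm_apply, Dart.symm_symm] at h
  have h1 : (M.rot (M.rot d).symm).snd = d.snd := by
    have h' : (M.rot (M.rot (M.rot d).symm).symm).fst = d.symm.fst := by rw [h]
    rwa [M.rot_fst] at h'
  have h2 := (M.rot (M.rot d).symm).adj
  rwa [h1, M.rot_fst] at h2

/-- A function on darts that is constant along the faces, and constant around each vertex of `S`,
is constant on the darts leaving a connected part of `S`. -/
lemma eq_of_linked [Finite G.Dart] {α : Type*} {g : G.Dart → α} {S : Set V}
    (hface : ∀ d, g d.symm = g (M.rot d)) (hrot : ∀ d, d.fst ∈ S → g (M.rot d) = g d)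
    {x y : V} (h : G.Linked S x y) {d e : G.Dart} (hd : d.fst = x) (he : e.fst = y) :
    g d = g e := by
  have hstar : ∀ {d e : G.Dart}, d.fst ∈ S → d.fst = e.fst → g d = g e := fun {d e} hdS hde =>
    M.rot_induction (P := fun z => g d = g z) hde rfl
      fun z hz hgz => hgz.trans (hrot z (hz ▸ hdS)).symm
  obtain ⟨p, hp⟩ := h
  induction p generalizing d with
  | nil => exact hstar (hd ▸ hp _ (by simp)) (hd.trans he.symm)
  | @cons u v w huv p ih =>
    have hu : u ∈ S := hp _ (by simp)
    have h1 : g d = g ⟨(u, v), huv⟩ := hstar (hd ▸ hu) hd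
    have h2 : g (Dart.symm ⟨(u, v), huv⟩) = g ⟨(u, v), huv⟩ := by
      rw [hface]
      exact hrot _ hu
    rw [h1, ← h2]
    exact ih rfl he fun z hz => hp z (by simp [hz])

/-! ### Homology of the sphere modulo two -/

/-- The face to the side of a dart. -/
def faceOf (d : G.Dart) : M.Face := Quotient.mk _ d

lemma faceOf_symm (d : G.Dart) : M.faceOf d.symm = M.faceOf (M.rot d) :=
  Quotient.sound (s := Equiv.Perm.SameCycle.setoid M.facePerm) ⟨1, rfl⟩

lemma faceOf_surjective : Function.Surjective M.faceOf := Quotient.mk_surjective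

/-- The edge under a dart. -/
def edgeOf (d : G.Dart) : G.edgeSet := ⟨d.edge, d.edge_mem⟩

lemma edgeOf_eq_iff {d e : G.Dart} : edgeOf d = edgeOf e ↔ d = e ∨ d = e.symm := by
  rw [edgeOf, edgeOf, Subtype.mk.injEq, dart_edge_eq_iff]

lemma edgeOf_surjective : Function.Surjective (edgeOf : G.Dart → G.edgeSet) := by
  rintro ⟨e, he⟩
  induction e with
  | _ x y => exact ⟨⟨(x, y), he⟩, rfl⟩

/-- The boundary map from chains of faces to chains of edges, with coefficients modulo two.
An arbitrary dart represents each edge; the value does not depend on it, see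
`faceBoundary_edgeOf`. -/
noncomputable def faceBoundary : (M.Face → ZMod 2) →ₗ[ZMod 2] (G.edgeSet → ZMod 2) where
  toFun f e := f (M.faceOf (Function.surjInv edgeOf_surjective e)) +
    f (M.faceOf (Function.surjInv edgeOf_surjective e).symm)
  map_add' f g := by
    ext e
    simp only [Pi.add_apply]
    ring
  map_smul' a f := by
    ext e
    simp only [Pi.smul_apply, smul_eq_mul, RingHom.id_apply]
    ring

lemma faceBoundary_edgeOf (f : M.Face → ZMod 2) (d : G.Dart) :
    M.faceBoundary f (edgeOf d) = f (M.faceOf d) + f (M.faceOf (M.rot d)) := by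
  rw [← faceOf_symm]
  change f (M.faceOf (Function.surjInv edgeOf_surjective (edgeOf d))) +
    f (M.faceOf (Function.surjInv edgeOf_surjective (edgeOf d)).symm) = _
  rcases edgeOf_eq_iff.1 (Function.surjInv_eq edgeOf_surjective (edgeOf d)) with h | h
  · rw [h]
  · rw [h, Dart.symm_symm, add_comm]

open Classical in
/-- The boundary map from chains of edges to chains of vertices, with coefficients modulo two. -/
noncomputable def edgeBoundary (G : SimpleGraph V) [Fintype G.Dart] :
    (G.edgeSet → ZMod 2) →ₗ[ZMod 2] (V → ZMod 2) where
  toFun c v := ∑ d : G.Dart with d.fst = v, c (edgeOf d)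
  map_add' c c' := by
    ext v
    simp only [Pi.add_apply, Finset.sum_add_distrib]
  map_smul' a c := by
    ext v
    simp only [Pi.smul_apply, smul_eq_mul, RingHom.id_apply, Finset.mul_sum]

open Classical in
lemma edgeBoundary_single [Fintype G.Dart] (d : G.Dart) :
    edgeBoundary G (Pi.single (edgeOf d) 1) = Pi.single d.fst 1 + Pi.single d.snd 1 := by
  ext v
  change ∑ e : G.Dart with e.fst = v, (Pi.single (edgeOf d) 1 : G.edgeSet → ZMod 2) (edgeOf e) = _
  have h : ∀ e : G.Dart, (Pi.single (edgeOf d) 1 : G.edgeSet → ZMod 2) (edgeOf e) =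
      (if e = d then 1 else 0) + (if e = d.symm then 1 else 0) := by
    intro e
    simp only [Pi.single_apply, edgeOf_eq_iff]
    by_cases h1 : e = d
    · subst h1
      simp [e.symm_ne.symm]
    · simp [h1]
  simp only [h, Finset.sum_add_distrib, Finset.sum_ite_eq', Finset.mem_filter, Finset.mem_univ,
    true_and, Pi.add_apply, Pi.single_apply]
  simp only [Dart.symm, Prod.fst_swap, eq_comm]

lemma edgeBoundary_faceBoundary [Fintype G.Dart] (f : M.Face → ZMod 2) :
    edgeBoundary G (M.faceBoundary f) = 0 := by
  classical
  ext v
  change ∑ d : G.Dart with d.fst = v, M.faceBoundary f (edgeOf d) = 0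
  simp only [faceBoundary_edgeOf, Finset.sum_add_distrib]
  have h : ∑ d : G.Dart with d.fst = v, f (M.faceOf (M.rot d)) =
      ∑ d : G.Dart with d.fst = v, f (M.faceOf d) :=
    Finset.sum_equiv M.rot (fun d => by simp [M.rot_fst]) (fun d _ => rfl)
  rw [h]
  exact CharTwo.add_self_eq_zero _

open Classical in
/-- A walk inside `S` is a chain of edges, supported in `S`, whose boundary is the sum of its two
ends. -/
lemma exists_chain_of_linked [Fintype G.Dart] {S : Set V} {x y : V} (h : G.Linked S x y) :
    ∃ c : G.edgeSet → ZMod 2, edgeBoundary G c = Pi.single x 1 + Pi.single y 1 ∧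
      ∀ d : G.Dart, d.fst ∉ S → c (edgeOf d) = 0 := by
  obtain ⟨p, hp⟩ := h
  induction p with
  | nil =>
    refine ⟨0, ?_, fun _ _ => rfl⟩
    ext z
    rw [map_zero, Pi.add_apply, CharTwo.add_self_eq_zero, Pi.zero_apply]
  | @cons u v w huv p ih =>
    obtain ⟨c, hc, hcS⟩ := ih fun z hz => hp z (by simp [hz])
    refine ⟨c + Pi.single (edgeOf ⟨(u, v), huv⟩) 1, ?_, fun d hd => ?_⟩
    · rw [map_add, hc, edgeBoundary_single]
      ext z
      simp only [Pi.add_apply]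
      linear_combination CharTwo.add_self_eq_zero ((Pi.single v 1 : V → ZMod 2) z)
    · rw [Pi.add_apply, hcS d hd, Pi.single_apply, if_neg, add_zero]
      rw [edgeOf_eq_iff]
      rintro (rfl | rfl)
      · exact hd (hp _ (by simp))
      · exact hd (hp _ (by simp [Dart.symm]))

/-- Every cycle modulo two bounds a set of faces: the first homology of the sphere vanishes.
Connectedness makes the kernel of `faceBoundary` and the cokernel of `edgeBoundary` at most
one-dimensional, so that Euler's formula leaves no room between the range of `faceBoundary` and
the kernel of `edgeBoundary`. -/
lemma IsPlaneTriangulation.exists_faceBoundary_eq [Fintype V] [Fintype G.Dart]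
    {M : RotationSystem G} (hM : M.IsPlaneTriangulation) {c : G.edgeSet → ZMod 2}
    (hc : edgeBoundary G c = 0) : ∃ f, M.faceBoundary f = c := by
  classical
  have : Finite M.Face := Quotient.finite _
  have : Fintype M.Face := Fintype.ofFinite _
  have hlinked : ∀ x y, G.Linked Set.univ x y := fun x y =>
    (hM.connected.preconnected x y).elim fun p => ⟨p, fun _ _ => trivial⟩
  have hker : Module.finrank (ZMod 2) (LinearMap.ker M.faceBoundary) ≤ 1 := by
    have hle : LinearMap.ker M.faceBoundary ≤ Submodule.span (ZMod 2) {1} := by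
      intro f hf
      rw [LinearMap.mem_ker] at hf
      have hrot : ∀ d, f (M.faceOf (M.rot d)) = f (M.faceOf d) := by
        intro d
        have h := M.faceBoundary_edgeOf f d
        rw [hf, Pi.zero_apply, eq_comm, CharTwo.add_eq_zero] at h
        exact h.symm
      rw [Submodule.mem_span_singleton]
      rcases isEmpty_or_nonempty M.Face with h | ⟨⟨q⟩⟩
      · exact ⟨0, Subsingleton.elim _ _⟩
      · obtain ⟨q, rfl⟩ := M.faceOf_surjective q
        refine ⟨f (M.faceOf q), ?_⟩
        ext r
        obtain ⟨r, rfl⟩ := M.faceOf_surjective r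
        rw [Pi.smul_apply, Pi.one_apply, smul_eq_mul, mul_one]
        exact M.eq_of_linked (g := fun d => f (M.faceOf d))
          (fun d => congrArg f (M.faceOf_symm d)) (fun d _ => hrot d) (hlinked q.fst r.fst) rfl rfl
    exact (Submodule.finrank_mono hle).trans (finrank_span_le_card _ |>.trans (by simp))
  have hrange : Fintype.card V ≤ Module.finrank (ZMod 2) (LinearMap.range (edgeBoundary G)) + 1 := by
    obtain ⟨v⟩ := hM.connected.nonempty
    have htop : LinearMap.range (edgeBoundary G) ⊔
        Submodule.span (ZMod 2) {(Pi.single v 1 : V → ZMod 2)} = ⊤ := by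
      rw [eq_top_iff, ← (Pi.basisFun (ZMod 2) V).span_eq, Submodule.span_le]
      rintro _ ⟨w, rfl⟩
      obtain ⟨b, hb, -⟩ := exists_chain_of_linked (hlinked v w)
      rw [Pi.basisFun_apply, SetLike.mem_coe, Submodule.mem_sup]
      refine ⟨_, ⟨b, rfl⟩, _, Submodule.mem_span_singleton_self _, ?_⟩
      rw [hb]
      ext z
      simp only [Pi.add_apply]
      linear_combination CharTwo.add_self_eq_zero ((Pi.single v 1 : V → ZMod 2) z)
    have h1 := Submodule.finrank_add_le_finrank_add_finrank (LinearMap.range (edgeBoundary G))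
      (Submodule.span (ZMod 2) {(Pi.single v 1 : V → ZMod 2)})
    rw [htop, finrank_top, Module.finrank_fintype_fun_eq_card] at h1
    have h2 : Module.finrank (ZMod 2) (Submodule.span (ZMod 2) {(Pi.single v 1 : V → ZMod 2)}) ≤ 1 :=
      finrank_span_le_card _ |>.trans (by simp)
    lia
  have h1 := LinearMap.finrank_range_add_finrank_ker M.faceBoundary
  have h2 := LinearMap.finrank_range_add_finrank_ker (edgeBoundary G)
  rw [Module.finrank_fintype_fun_eq_card] at h1 h2
  have heuler := hM.euler
  rw [Nat.card_eq_fintype_card, Nat.card_eq_fintype_card, Nat.card_eq_fintype_card] at heuler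
  have hle : LinearMap.range M.faceBoundary ≤ LinearMap.ker (edgeBoundary G) := by
    rintro _ ⟨f, rfl⟩
    exact M.edgeBoundary_faceBoundary f
  have heq := Submodule.eq_of_le_of_finrank_le hle (by lia)
  have hmem : c ∈ LinearMap.range M.faceBoundary := heq ▸ LinearMap.mem_ker.2 hc
  exact hmem

/-- Disjoint paths do not cross at a vertex `v`. Two neighbours `d.snd` and `e.snd` of `v` joined
inside `S` close up to a cycle through `v`; it bounds a set of faces, which changes at `d` as one
turns around `v`, but not along a path inside `T` between the neighbours of `v` before and after
`d.snd`. -/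
lemma IsPlaneTriangulation.not_linked_of_linked [Fintype V] [Fintype G.Dart]
    {M : RotationSystem G} (hM : M.IsPlaneTriangulation) {S T : Set V} (hST : Disjoint S T)
    {v : V} (hvS : v ∉ S) (hvT : v ∉ T) {d e : G.Dart} (hd : d.fst = v) (he : e.fst = v)
    (hde : d ≠ e) (hS : G.Linked S d.snd e.snd) :
    ¬ G.Linked T (M.rot d).snd (M.rot.symm d).snd := by
  classical
  intro hT
  have hdS : d.snd ∈ S := hS.elim fun p hp => hp _ p.start_mem_support
  have heS : e.snd ∈ S := hS.elim fun p hp => hp _ p.end_mem_support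
  have haT : (M.rot d).snd ∈ T := hT.elim fun p hp => hp _ p.start_mem_support
  obtain ⟨c, hc, hcS⟩ := exists_chain_of_linked hS
  obtain ⟨f, hf⟩ := hM.exists_faceBoundary_eq
    (c := Pi.single (edgeOf d) 1 + Pi.single (edgeOf e) 1 + c) (by
      rw [map_add, map_add, hc, edgeBoundary_single, edgeBoundary_single, hd, he]
      ext z
      simp only [Pi.add_apply, Pi.zero_apply]
      linear_combination CharTwo.add_self_eq_zero ((Pi.single v 1 : V → ZMod 2) z) +
        CharTwo.add_self_eq_zero ((Pi.single d.snd 1 : V → ZMod 2) z) +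
        CharTwo.add_self_eq_zero ((Pi.single e.snd 1 : V → ZMod 2) z))
  have hne : ∀ x y : G.Dart, x.fst ∈ T → y.fst = v → y.snd ∈ S → edgeOf x ≠ edgeOf y := by
    intro x y hx hy hyS hxy
    rcases edgeOf_eq_iff.1 hxy with rfl | rfl
    · exact hvT (hy ▸ hx)
    · exact hST.notMem_of_mem_left hyS hx
  have hface : ∀ x, f (M.faceOf x.symm) = f (M.faceOf (M.rot x)) := fun x =>
    congrArg f (M.faceOf_symm x)
  have hrot : ∀ x : G.Dart, x.fst ∈ T → f (M.faceOf (M.rot x)) = f (M.faceOf x) := by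
    intro x hx
    have h := M.faceBoundary_edgeOf f x
    rw [hf, Pi.add_apply, Pi.add_apply, Pi.single_eq_of_ne (hne x d hx hd hdS),
      Pi.single_eq_of_ne (hne x e hx he heS), hcS x (hST.notMem_of_mem_right hx), add_zero,
      add_zero, eq_comm, CharTwo.add_eq_zero] at h
    exact h.symm
  have h1 : f (M.faceOf (M.rot d).symm) = f (M.faceOf (M.rot.symm d).symm) :=
    M.eq_of_linked (g := fun x => f (M.faceOf x)) hface hrot hT rfl rfl
  have h2 : f (M.faceOf (M.rot d)) = f (M.faceOf (M.rot d).symm) := by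
    have h := hface (M.rot d).symm
    rw [Dart.symm_symm] at h
    rw [h, hrot _ haT]
  have h3 : f (M.faceOf (M.rot.symm d).symm) = f (M.faceOf d) := by
    rw [hface, Equiv.apply_symm_apply]
  have hne' : edgeOf d ≠ edgeOf e := by
    rw [Ne, edgeOf_eq_iff]
    rintro (h | h)
    · exact hde h
    · refine hvS ?_
      have h' : d.fst = e.snd := by rw [h]; rfl
      rwa [← hd, h']
  have h := M.faceBoundary_edgeOf f d
  rw [hf, Pi.add_apply, Pi.add_apply, Pi.single_eq_same, Pi.single_eq_of_ne hne',
    hcS d (hd ▸ hvS), h2, h1, h3, CharTwo.add_self_eq_zero] at h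
  exact absurd h (by decide)

end RotationSystem

/-! ### Induced forests -/

namespace SimpleGraph

variable {V : Type*} {G : SimpleGraph V}

lemma Linked.symm {S : Set V} {x y : V} (h : G.Linked S x y) : G.Linked S y x := by
  obtain ⟨p, hp⟩ := h
  exact ⟨p.reverse, fun z hz => hp z (by simpa using hz)⟩

lemma Linked.left_mem {S : Set V} {x y : V} (h : G.Linked S x y) : x ∈ S :=
  h.elim fun p hp => hp _ p.start_mem_support

lemma Linked.right_mem {S : Set V} {x y : V} (h : G.Linked S x y) : y ∈ S :=
  h.symm.left_mem

lemma Linked.refl {S : Set V} {x : V} (h : x ∈ S) : G.Linked S x x :=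
  ⟨Walk.nil, by simpa using h⟩

lemma isAcyclic_induce_iff {S : Set V} : (G.induce S).IsAcyclic ↔
    ∀ u (p : G.Walk u u), (∀ z ∈ p.support, z ∈ S) → ¬ p.IsCycle := by
  constructor
  · intro h u p hp hc
    refine h (p.induce S hp) ?_
    rw [← Walk.isCycle_map_iff_of_injective (f := (Embedding.induce S).toHom)
      (Embedding.induce (G := G) S).injective, Walk.map_induce]
    exact hc
  · intro h u p hc
    refine h _ (p.map (Embedding.induce S).toHom) ?_
      (hc.map (Embedding.induce (G := G) S).injective)
    intro z hz
    rw [Walk.support_map, List.mem_map] at hz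
    obtain ⟨w, -, rfl⟩ := hz
    exact w.2

/-- A vertex can be added to an induced forest unless two of its neighbours are already joined
there. -/
lemma exists_linked_of_not_isAcyclic_insert {S : Set V} {v : V} (hS : (G.induce S).IsAcyclic)
    (h : ¬ (G.induce (insert v S)).IsAcyclic) :
    ∃ x y, x ≠ y ∧ G.Adj v x ∧ G.Adj v y ∧ G.Linked S x y := by
  classical
  rw [isAcyclic_induce_iff] at hS h
  push Not at h
  obtain ⟨u, p, hp, hc⟩ := h
  have hv : v ∈ p.support := by
    by_contra hv
    exact hS u p (fun z hz => (hp z hz).resolve_left fun h => hv (h ▸ hz)) hc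
  have hq : ∀ z ∈ (p.rotate v hv).support, z ∈ insert v S := fun z hz =>
    hp z ((p.mem_support_rotate_iff v hv).1 hz)
  have hqc := hc.rotate hv
  generalize p.rotate v hv = q at hq hqc
  cases q with
  | nil => exact absurd rfl hqc.ne_nil
  | @cons _ x _ hvx q =>
    rw [Walk.cons_isCycle_iff] at hqc
    obtain ⟨hqp, hqe⟩ := hqc
    have hr := hqp.reverse
    have hre : s(v, x) ∉ q.reverse.edges := by rwa [Walk.edges_reverse, List.mem_reverse]
    have hrs : ∀ z ∈ q.reverse.support, z ∈ insert v S := fun z hz =>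
      hq z (by rw [Walk.support_cons]; exact List.mem_cons_of_mem _ (by simpa using hz))
    generalize q.reverse = r at hr hre hrs
    cases r with
    | nil => exact absurd hvx (G.loopless.irrefl _)
    | @cons _ y _ hvy r =>
      rw [Walk.cons_isPath_iff] at hr
      refine ⟨y, x, ?_, hvy, hvx, r, fun z hz => ?_⟩
      · rintro rfl
        exact hre (by simp)
      · exact (hrs z (by simp [hz])).resolve_left fun h => hr.2 (h ▸ hz)

lemma IsAcyclic.card_edgeSet_add_one_le {W : Type*} [Finite W] [Nonempty W] {H : SimpleGraph W}
    (hH : H.IsAcyclic) :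
    Nat.card H.edgeSet + 1 ≤ Nat.card W ∧ (Nat.card W ≤ Nat.card H.edgeSet + 1 → H.IsTree) := by
  obtain ⟨T, hHT, -, hT⟩ := connected_top.exists_isTree_le_of_le_of_isAcyclic
    (le_top : H ≤ ⊤) hH
  have hcard := (isTree_iff_connected_and_card.1 hT).2
  have hsub : H.edgeSet ⊆ T.edgeSet := edgeSet_mono hHT
  have hle : Nat.card H.edgeSet ≤ Nat.card T.edgeSet := Nat.card_mono (Set.toFinite _) hsub
  refine ⟨by lia, fun h => ?_⟩
  have heq : H.edgeSet = T.edgeSet := Set.eq_of_subset_of_ncard_le hsub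
    (by rw [← Nat.card_coe_set_eq, ← Nat.card_coe_set_eq]; lia)
  rw [edgeSet_inj.1 heq]
  exact hT

lemma card_darts_induce_le [Fintype V] [Fintype G.Dart] (S : Set V) :
    Nat.card {d : G.Dart // d.fst ∈ S ∧ d.snd ∈ S} ≤ 2 * Nat.card (G.induce S).edgeSet := by
  classical
  rw [Nat.card_eq_fintype_card (α := (G.induce S).edgeSet), ← edgeFinset_card,
    ← dart_card_eq_twice_card_edges, ← Nat.card_eq_fintype_card]
  refine Nat.card_le_card_of_injective
    (fun d => (⟨(⟨d.1.fst, d.2.1⟩, ⟨d.1.snd, d.2.2⟩), d.1.adj⟩ : (G.induce S).Dart)) ?_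
  intro d e h
  have h1 := congrArg (fun x : (G.induce S).Dart => x.fst.1) h
  have h2 := congrArg (fun x : (G.induce S).Dart => x.snd.1) h
  exact Subtype.ext (Dart.ext _ _ (Prod.ext h1 h2))

end SimpleGraph

namespace RotationSystem

variable {V : Type*} {G : SimpleGraph V} {M : RotationSystem G}

/-! ### Two complementary induced forests are trees -/

lemma IsPlaneTriangulation.card_dart_le [Finite G.Dart] (hM : M.IsPlaneTriangulation) :
    Nat.card G.Dart ≤ 3 * Nat.card M.Face := by
  have : Finite M.Face := Quotient.finite _
  have hsurj : Function.Surjective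
      (fun q : Fin 3 × M.Face => (M.facePerm ^ (q.1 : ℕ)) q.2.out) := by
    intro d
    have h : M.facePerm.SameCycle (M.faceOf d).out d :=
      Quotient.mk_out (s := Equiv.Perm.SameCycle.setoid M.facePerm) d
    obtain ⟨n, hn⟩ := h.exists_nat_pow_eq
    have h3 : M.facePerm ^ 3 = 1 := by
      ext1 x
      exact hM.face_triangle x
    refine ⟨(⟨n % 3, Nat.mod_lt _ (by norm_num)⟩, M.faceOf d), ?_⟩
    change (M.facePerm ^ (n % 3)) (M.faceOf d).out = d
    refine Eq.trans ?_ hn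
    conv_rhs => rw [← Nat.mod_add_div n 3, pow_add, pow_mul, h3, one_pow, mul_one]
  simpa using Nat.card_le_card_of_surjective _ hsurj

lemma IsPlaneTriangulation.not_isAcyclic [Fintype V] [Fintype G.Dart]
    (hM : M.IsPlaneTriangulation) : ¬ G.IsAcyclic := by
  classical
  intro h
  rcases isEmpty_or_nonempty G.Dart with hD | ⟨⟨d⟩⟩
  · have h1 := hM.card_dart_le
    have hF : IsEmpty M.Face := ⟨fun q => hD.false (Quotient.out q)⟩
    have hE : IsEmpty G.edgeSet := ⟨fun e => hD.false (edgeOf_surjective e).choose⟩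
    have h2 := hM.connected.card_vert_le_card_edgeSet_add_one
    have h3 := hM.euler
    rw [Nat.card_of_isEmpty (α := G.edgeSet)] at h2 h3
    rw [Nat.card_of_isEmpty (α := M.Face)] at h3
    lia
  · refine h.cliqueFree le_rfl {d.fst, d.snd, (M.rot d).snd} ?_
    rw [is3Clique_triple_iff]
    refine ⟨d.adj, ?_, (hM.adj_rot_snd d).symm⟩
    rw [← M.rot_fst]
    exact (M.rot d).adj

/-- If a plane triangulation is partitioned into two induced forests, both are trees. Every
triangle has a side inside one of the two parts, so at least a third of the `3 |V| - 6` edges lie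
inside the parts, and forests with `s` and `t` components have only `|V| - s - t` edges. -/
lemma IsPlaneTriangulation.isTree_of_isAcyclic [Fintype V] [DecidableRel G.Adj]
    (hM : M.IsPlaneTriangulation) {S T : Set V} (hdisj : Disjoint S T) (hcover : S ∪ T = Set.univ)
    (hS : (G.induce S).IsAcyclic) (hT : (G.induce T).IsAcyclic) :
    (G.induce S).IsTree ∧ (G.induce T).IsTree := by
  classical
  have hne : ∀ A B : Set V, A ∪ B = Set.univ → (G.induce B).IsAcyclic → Nonempty A := by
    intro A B hAB hB
    rw [Set.nonempty_coe_sort, Set.nonempty_iff_ne_empty]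
    rintro rfl
    rw [Set.empty_union] at hAB
    subst hAB
    exact hM.not_isAcyclic fun u p =>
      isAcyclic_induce_iff.1 hB u p fun z _ => Set.mem_univ z
  have hSne : Nonempty S := hne S T hcover hT
  have hTne : Nonempty T := hne T S (by rw [Set.union_comm, hcover]) hS
  have hcard : Nat.card S + Nat.card T = Nat.card V := by
    rw [Nat.card_coe_set_eq, Nat.card_coe_set_eq, ← Set.ncard_union_eq hdisj, hcover,
      Set.ncard_univ]
  let m : G.Dart → ℕ := fun d =>
    (if d.fst ∈ S ∧ d.snd ∈ S then 1 else 0) + (if d.fst ∈ T ∧ d.snd ∈ T then 1 else 0)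
  have hm : ∑ d, m d = Nat.card {d : G.Dart // d.fst ∈ S ∧ d.snd ∈ S} +
      Nat.card {d : G.Dart // d.fst ∈ T ∧ d.snd ∈ T} := by
    simp only [m, Finset.sum_add_distrib, Nat.card_eq_fintype_card, Fintype.card_subtype,
      Finset.card_filter]
  have hmS := G.card_darts_induce_le S
  have hmT := G.card_darts_induce_le T
  have hface : ∀ d, 1 ≤ m d + m (M.facePerm d) + m (M.facePerm (M.facePerm d)) := by
    intro d
    have h1 : (M.facePerm d).fst = d.snd := M.rot_fst _
    have h2 : (M.facePerm (M.facePerm d)).fst = (M.facePerm d).snd := M.rot_fst _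
    have h3 : (M.facePerm (M.facePerm d)).snd = d.fst := by
      have h : (M.facePerm (M.facePerm (M.facePerm d))).fst =
        (M.facePerm (M.facePerm d)).snd := M.rot_fst _
      rw [← h, hM.face_triangle]
    have hmem : ∀ v, v ∈ S ∨ v ∈ T := fun v => by
      rw [← Set.mem_union, hcover]
      trivial
    simp only [m, h1, h2, h3]
    have a1 := hmem d.fst
    have a2 := hmem d.snd
    have a3 := hmem (M.facePerm d).snd
    split_ifs <;> lia
  have hsum := Finset.sum_le_sum fun (d : G.Dart) (_ : d ∈ Finset.univ) => hface d
  rw [Finset.sum_add_distrib, Finset.sum_add_distrib, Equiv.sum_comp M.facePerm m,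
    Equiv.sum_comp M.facePerm fun d => m (M.facePerm d), Equiv.sum_comp M.facePerm m,
    Finset.sum_const, smul_eq_mul, mul_one, Finset.card_univ] at hsum
  have hdarts : Fintype.card G.Dart = 2 * Nat.card G.edgeSet := by
    rw [dart_card_eq_twice_card_edges, edgeFinset_card, Nat.card_eq_fintype_card]
  have hfaces := hM.card_dart_le
  rw [Nat.card_eq_fintype_card] at hfaces
  have heuler := hM.euler
  obtain ⟨hS1, hS2⟩ := hS.card_edgeSet_add_one_le
  obtain ⟨hT1, hT2⟩ := hT.card_edgeSet_add_one_le
  exact ⟨hS2 (by lia), hT2 (by lia)⟩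

/-! ### Neighbours of a small vertex -/

/-- The neighbours before and after a neighbour have the third colour. -/
lemma IsPlaneTriangulation.color_rot (hM : M.IsPlaneTriangulation)
    (c : G.Coloring (Fin 3)) {d : G.Dart} {w : V}
    (hw : G.Adj d.fst w) (hwd : c w ≠ c d.snd) :
    c (M.rot d).snd = c w ∧ c (M.rot.symm d).snd = c w := by
  have h1 := c.valid d.adj
  have h2 := c.valid hw
  have h3 := c.valid (hM.adj_rot_snd d)
  have h4 := c.valid (M.rot d).adj
  have h5 := c.valid (hM.adj_rot_snd (M.rot.symm d))
  have h6 := c.valid (M.rot.symm d).adj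
  rw [M.rot_fst] at h4
  rw [Equiv.apply_symm_apply] at h5
  rw [M.rot_symm_fst] at h6
  constructor <;> lia

variable [Fintype V] [DecidableRel G.Adj] (c : G.Coloring (Fin 3))

/-- The colours of the neighbours of a vertex alternate in the rotation, so that a vertex that is
not big has at most two neighbours of each colour. -/
lemma IsPlaneTriangulation.not_three_neighbors (hM : M.IsPlaneTriangulation) {v x y z : V}
    (hv : v ∉ bigVertices G) (hx : G.Adj v x) (hy : G.Adj v y) (hz : G.Adj v z)
    (hxy : c x = c y) (hxz : c x = c z) (nxy : x ≠ y) (nxz : x ≠ z) (nyz : y ≠ z) : False := by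
  classical
  let A : Finset G.Dart := {⟨(v, x), hx⟩, ⟨(v, y), hy⟩, ⟨(v, z), hz⟩}
  have hA : ∀ d ∈ A, d.fst = v ∧ c d.snd = c x := by
    simp [A, hxy, ← hxz]
  have hAcard : A.card = 3 := Finset.card_eq_three.2
    ⟨_, _, _, by simpa using nxy, by simpa using nxz, by simpa using nyz, rfl⟩
  have hdisj : Disjoint A (A.map M.rot.toEmbedding) := by
    rw [Finset.disjoint_right]
    intro d hd hd'
    rw [Finset.mem_map] at hd
    obtain ⟨e, he, rfl⟩ := hd
    exact c.valid (hM.adj_rot_snd e) ((hA _ hd').2.trans (hA e he).2.symm)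
  have hsub : A ∪ A.map M.rot.toEmbedding ⊆ Finset.univ.filter fun d : G.Dart => d.fst = v := by
    intro d hd
    rw [Finset.mem_filter]
    refine ⟨Finset.mem_univ _, ?_⟩
    rcases Finset.mem_union.1 hd with hd | hd
    · exact (hA d hd).1
    · obtain ⟨e, he, rfl⟩ := Finset.mem_map.1 hd
      exact (M.rot_fst e).trans (hA e he).1
  have hcard := Finset.card_le_card hsub
  have hdeg : (Finset.univ.filter fun d : G.Dart => d.fst = v).card = G.degree v := by
    convert G.dart_fst_fiber_card_eq_degree v
  rw [Finset.card_union_of_disjoint hdisj, Finset.card_map, hAcard, hdeg] at hcard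
  exact hv hcard

/-- Around a vertex that is not big and has two neighbours of some colour, all neighbours of that
colour are adjacent to all neighbours of the other one. -/
lemma IsPlaneTriangulation.adj_of_neighbors (hM : M.IsPlaneTriangulation) {v x y z : V}
    (hv : v ∉ bigVertices G) (hx : G.Adj v x) (hy : G.Adj v y) (hz : G.Adj v z)
    (hxy : c x = c y) (nxy : x ≠ y) (hyz : c z ≠ c y) : G.Adj y z := by
  let d : G.Dart := ⟨(v, y), hy⟩
  have hcol := hM.color_rot c (d := d) hz hyz
  have hadj : ∀ e : G.Dart, e.fst = v → G.Adj v e.snd := fun e he => he ▸ e.adj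
  have hfst : (M.rot d).fst = v := M.rot_fst d
  have hfst' : (M.rot.symm d).fst = v := M.rot_symm_fst d
  have h1 : G.Adj y (M.rot d).snd := (hM.adj_rot_snd d).symm
  have h2 : G.Adj y (M.rot.symm d).snd := by
    have h := hM.adj_rot_snd (M.rot.symm d)
    rwa [Equiv.apply_symm_apply] at h
  by_contra hyz'
  refine hM.not_three_neighbors c hv hz (hadj _ hfst) (hadj _ hfst') hcol.1.symm hcol.2.symm
    (fun h => hyz' (h ▸ h1)) (fun h => hyz' (h ▸ h2)) fun h => ?_
  -- if the neighbours before and after `y` agree, the rotation closes up after two steps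
  have heq : M.rot d = M.rot.symm d := Dart.ext _ _ (Prod.ext (hfst.trans hfst'.symm) h)
  have hclosed := M.rot_induction (P := fun e => e = d ∨ e = M.rot d)
    (e := ⟨(v, x), hx⟩) (d := d) rfl (Or.inl rfl) (by
      rintro _ - (rfl | rfl)
      · exact Or.inr rfl
      · exact Or.inl (by rw [heq, Equiv.apply_symm_apply]))
  rcases hclosed with h | h
  · exact nxy (congrArg (fun e : G.Dart => e.snd) h)
  · exact hyz ((hcol.1.symm.trans (congrArg (fun e : G.Dart => c e.snd) h).symm).trans hxy)

/-- A vertex that is not big and has two neighbours of the same colour joined inside `S` can be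
added to a forest disjoint from `S`: its neighbours there are separated by the cycle in `S`. -/
lemma IsPlaneTriangulation.color_ne_of_linked (hM : M.IsPlaneTriangulation) {S T : Set V}
    (hST : Disjoint S T) {v x x' y y' : V} (hv : v ∉ bigVertices G) (hvS : v ∉ S) (hvT : v ∉ T)
    (hx : G.Adj v x) (hx' : G.Adj v x') (nx : x ≠ x') (hS : G.Linked S x x')
    (hy : G.Adj v y) (hy' : G.Adj v y') (ny : y ≠ y') (hT : G.Linked T y y') : c x ≠ c x' := by
  intro hxx'
  have hST' : ∀ {a b}, a ∈ S → b ∈ T → a ≠ b := fun ha hb h =>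
    hST.notMem_of_mem_left ha (h ▸ hb)
  have hxy : ∀ {w}, G.Adj v w → w ∈ T → c w ≠ c x := fun hw hwT h =>
    hM.not_three_neighbors c hv hx hx' hw hxx' h.symm nx (hST' hS.left_mem hwT)
      (hST' hS.right_mem hwT)
  have hyx := hxy hy hT.left_mem
  have hyx' := hxy hy' hT.right_mem
  have hyy' : c y = c y' := by
    have h1 := c.valid hx
    have h2 := c.valid hy
    have h3 := c.valid hy'
    lia
  let d : G.Dart := ⟨(v, x), hx⟩
  have hcol := hM.color_rot c (d := d) hy hyx
  have hcases : ∀ e : G.Dart, e.fst = v → c e.snd = c y → e.snd = y ∨ e.snd = y' := by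
    intro e he hey
    by_contra! h
    exact hM.not_three_neighbors c hv hy hy' (he ▸ e.adj) hyy' hey.symm ny h.1.symm h.2.symm
  refine hM.not_linked_of_linked hST hvS hvT (d := d) (e := ⟨(v, x'), hx'⟩) rfl rfl
    (fun h => nx (congrArg (fun e : G.Dart => e.snd) h)) hS ?_
  rcases hcases _ (M.rot_fst d) hcol.1 with h1 | h1 <;>
    rcases hcases _ (M.rot_symm_fst d) hcol.2 with h2 | h2 <;> rw [h1, h2]
  · exact Linked.refl hT.left_mem
  · exact hT
  · exact hT.symm
  · exact Linked.refl hT.right_mem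

/-! ### Extending the forests -/

/-- The small vertices of colour `0` can be distributed over the two forests so that such a vertex
goes to the second forest only if all its neighbours of colour `2` lie in `X`. -/
lemma IsPlaneTriangulation.exists_extend_color_zero (hM : M.IsPlaneTriangulation) {X Y : Set V}
    (hXY : Disjoint X Y) (hX : X ⊆ bigVertices G) (hY : Y ⊆ bigVertices G)
    (h1 : bigClass G c 0 ⊆ X) (h2 : bigClass G c 1 ⊆ Y)
    (hXacyc : (G.induce X).IsAcyclic) (hYacyc : (G.induce Y).IsAcyclic) (U : Finset V)
    (hU : ∀ u ∈ U, c u = 0 ∧ u ∉ bigVertices G) :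
    ∃ S T : Set V, Disjoint S T ∧ S ∪ T = X ∪ Y ∪ U ∧ X ⊆ S ∧ Y ⊆ T ∧
      (G.induce S).IsAcyclic ∧ (G.induce T).IsAcyclic ∧
      ∀ y ∈ T, c y = 0 → ∀ w, G.Adj y w → c w = 2 → w ∈ X := by
  classical
  induction U using Finset.induction_on with
  | empty =>
    exact ⟨X, Y, hXY, by simp, subset_rfl, subset_rfl, hXacyc, hYacyc, fun y hy hy0 =>
      absurd hy (hXY.notMem_of_mem_left (h1 ⟨hy0, hY hy⟩))⟩
  | insert v U hvU ih =>
    obtain ⟨S, T, hST, hcover, hXS, hYT, hS, hT, hTX⟩ :=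
      ih fun u hu => hU u (Finset.mem_insert_of_mem hu)
    obtain ⟨hv0, hv⟩ := hU v (Finset.mem_insert_self _ _)
    have hvST : v ∉ S ∪ T := by
      rw [hcover]
      rintro ((h | h) | h)
      exacts [hv (hX h), hv (hY h), hvU h]
    have hvS : v ∉ S := fun h => hvST (Or.inl h)
    have hvT : v ∉ T := fun h => hvST (Or.inr h)
    by_cases hSv : (G.induce (insert v S)).IsAcyclic
    · refine ⟨insert v S, T, Set.disjoint_insert_left.2 ⟨hvT, hST⟩, ?_,
        hXS.trans (Set.subset_insert _ _), hYT, hSv, hT, hTX⟩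
      rw [Set.insert_union, hcover, Finset.coe_insert, Set.union_insert]
    obtain ⟨x, x', nx, hx, hx', hxx'⟩ := exists_linked_of_not_isAcyclic_insert hS hSv
    have hcol : ∀ {w}, G.Adj v w → w ∈ S → w ∈ X ∧ c w = 2 := by
      intro w hw hwS
      have hw0 : c w ≠ 0 := fun h => c.valid hw (hv0.trans h.symm)
      have hwX : w ∈ X := by
        have hmem : w ∈ X ∪ Y ∪ U := hcover ▸ Or.inl hwS
        rcases hmem with (h | h) | h
        · exact h
        · exact absurd (hYT h) (hST.notMem_of_mem_left hwS)
        · exact absurd (hU w (Finset.mem_insert_of_mem h)).1 hw0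
      have hw1 : c w ≠ 1 := fun h => hXY.notMem_of_mem_left hwX (h2 ⟨h, hX hwX⟩)
      exact ⟨hwX, by lia⟩
    obtain ⟨hxX, hx2⟩ := hcol hx hxx'.left_mem
    obtain ⟨hxX', hx2'⟩ := hcol hx' hxx'.right_mem
    refine ⟨S, insert v T, Set.disjoint_insert_right.2 ⟨hvS, hST⟩, ?_, hXS,
      hYT.trans (Set.subset_insert _ _), hS, ?_, ?_⟩
    · rw [Set.union_insert, hcover, Finset.coe_insert, Set.union_insert]
    · by_contra hTv
      obtain ⟨y, y', ny, hy, hy', hyy'⟩ := exists_linked_of_not_isAcyclic_insert hT hTv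
      exact hM.color_ne_of_linked c hST hv hvS hvT hx hx' nx hxx' hy hy' ny hyy'
        (hx2.trans hx2'.symm)
    · rintro y (rfl | hy) hy0 w hyw hw
      · by_contra hwX
        exact hM.not_three_neighbors c hv hx hx' hyw (hx2.trans hx2'.symm) (hx2.trans hw.symm) nx
          (fun h => hwX (h ▸ hxX)) (fun h => hwX (h ▸ hxX'))
      · exact hTX y hy hy0 w hyw hw

/-- Suppose that `S₀` and `T₀` contain all big vertices and all vertices of colour `0`, and that
the vertices of colour `0` in `T₀` have all their neighbours of colour `2` in `X`. Then the
remaining vertices can be added to the two forests in any order. -/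
lemma IsPlaneTriangulation.exists_extend (hM : M.IsPlaneTriangulation) {X S₀ T₀ : Set V}
    (hST₀ : Disjoint S₀ T₀) (hXS : X ⊆ S₀)
    (hbig : bigVertices G ⊆ S₀ ∪ T₀) (hzero : ∀ v, c v = 0 → v ∈ S₀ ∪ T₀)
    (hTX : ∀ y ∈ T₀, c y = 0 → ∀ w, G.Adj y w → c w = 2 → w ∈ X)
    (hS₀ : (G.induce S₀).IsAcyclic) (hT₀ : (G.induce T₀).IsAcyclic) (U : Finset V)
    (hU : ∀ u ∈ U, u ∉ S₀ ∪ T₀) :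
    ∃ S T : Set V, Disjoint S T ∧ S ∪ T = S₀ ∪ T₀ ∪ U ∧ S₀ ⊆ S ∧ T₀ ⊆ T ∧
      (G.induce S).IsAcyclic ∧ (G.induce T).IsAcyclic := by
  classical
  induction U using Finset.induction_on with
  | empty => exact ⟨S₀, T₀, hST₀, by simp, subset_rfl, subset_rfl, hS₀, hT₀⟩
  | insert v U hvU ih =>
    obtain ⟨S, T, hST, hcover, hSS, hTT, hS, hT⟩ :=
      ih fun u hu => hU u (Finset.mem_insert_of_mem hu)
    have hv₀ := hU v (Finset.mem_insert_self _ _)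
    have hv : v ∉ bigVertices G := fun h => hv₀ (hbig h)
    have hvST : v ∉ S ∪ T := by
      rw [hcover]
      rintro (h | h)
      exacts [hv₀ h, hvU h]
    have hvS : v ∉ S := fun h => hvST (Or.inl h)
    have hvT : v ∉ T := fun h => hvST (Or.inr h)
    by_cases hSv : (G.induce (insert v S)).IsAcyclic
    · refine ⟨insert v S, T, Set.disjoint_insert_left.2 ⟨hvT, hST⟩, ?_,
        hSS.trans (Set.subset_insert _ _), hTT, hSv, hT⟩
      rw [Set.insert_union, hcover, Finset.coe_insert, Set.union_insert]
    by_cases hTv : (G.induce (insert v T)).IsAcyclic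
    · refine ⟨S, insert v T, Set.disjoint_insert_right.2 ⟨hvS, hST⟩, ?_,
        hSS, hTT.trans (Set.subset_insert _ _), hS, hTv⟩
      rw [Set.union_insert, hcover, Finset.coe_insert, Set.union_insert]
    exfalso
    obtain ⟨x, x', nx, hx, hx', hxx'⟩ := exists_linked_of_not_isAcyclic_insert hS hSv
    obtain ⟨y, y', ny, hy, hy', hyy'⟩ := exists_linked_of_not_isAcyclic_insert hT hTv
    have ncx := hM.color_ne_of_linked c hST hv hvS hvT hx hx' nx hxx' hy hy' ny hyy'
    have ncy := hM.color_ne_of_linked c hST.symm hv hvT hvS hy hy' ny hyy' hx hx' nx hxx'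
    have hcv : c v ≠ 0 := fun h => hv₀ (hzero v h)
    -- each pair contains one neighbour of colour `0`
    wlog hx0 : c x = 0 generalizing x x'
    · refine this x' x nx.symm hx' hx hxx'.symm ncx.symm ?_
      have h1 := c.valid hx
      have h2 := c.valid hx'
      lia
    wlog hy0 : c y = 0 generalizing y y'
    · refine this y' y ny.symm hy' hy hyy'.symm ncy.symm ?_
      have h1 := c.valid hy
      have h2 := c.valid hy'
      lia
    have hyT₀ : y ∈ T₀ := (hzero y hy0).resolve_left fun h =>
      hST.notMem_of_mem_left (hSS h) hyy'.left_mem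
    have hyX := hTX y hyT₀ hy0
    by_cases hv2 : c v = 2
    · exact hv₀ (Or.inl (hXS (hyX v hy.symm hv2)))
    · have hy2 : c y' = 2 := by
        have h1 := c.valid hy'
        lia
      have hadj : G.Adj y y' := hM.adj_of_neighbors c hv hx hy hy' (hx0.trans hy0.symm)
        (fun h => hST.notMem_of_mem_left hxx'.left_mem (h ▸ hyy'.left_mem)) ncy.symm
      exact hST.notMem_of_mem_left (hSS (hXS (hyX y' hadj hy2))) hyy'.right_mem

end RotationSystem

theorem corollary2p1 {V : Type*} [Fintype V] (G : SimpleGraph V) [DecidableRel G.Adj]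
    (M : RotationSystem G) (hM : M.IsPlaneTriangulation)
    (heven : ∀ v : V, Even (G.degree v))
    (c : G.Coloring (Fin 3)) (X Y : Set V) (hXY : Disjoint X Y)
    (hX : X ⊆ bigVertices G) (hY : Y ⊆ bigVertices G)
    (h1 : bigClass G c 0 ⊆ X) (h2 : bigClass G c 1 ⊆ Y) (h3 : bigClass G c 2 ⊆ X ∪ Y)
    (hXacyc : (G.induce X).IsAcyclic) (hYacyc : (G.induce Y).IsAcyclic) :
    ∃ S T : Set V, Disjoint S T ∧ S ∪ T = Set.univ ∧
      (G.induce S).IsTree ∧ (G.induce T).IsTree := by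
  classical
  obtain ⟨S₀, T₀, hST₀, hcover₀, hXS, -, hS₀, hT₀, hTX⟩ :=
    hM.exists_extend_color_zero c hXY hX hY h1 h2 hXacyc hYacyc
      {v | c v = 0 ∧ v ∉ bigVertices G} (by simp)
  have hbig : bigVertices G ⊆ X ∪ Y := by
    intro v hv
    by_cases hv0 : c v = 0
    · exact Or.inl (h1 ⟨hv0, hv⟩)
    · by_cases hv1 : c v = 1
      · exact Or.inr (h2 ⟨hv1, hv⟩)
      · exact h3 ⟨by lia, hv⟩
  have hzero : ∀ v, c v = 0 → v ∈ S₀ ∪ T₀ := by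
    intro v hv
    rw [hcover₀]
    by_cases hvb : v ∈ bigVertices G
    · exact Or.inl (hbig hvb)
    · exact Or.inr (by simp [hv, hvb])
  obtain ⟨S, T, hST, hcover, -, -, hS, hT⟩ := hM.exists_extend c hST₀ hXS
    (hbig.trans (hcover₀ ▸ Set.subset_union_left)) hzero hTX hS₀ hT₀ {v | v ∉ S₀ ∪ T₀} (by simp)
  have huniv : S ∪ T = Set.univ := by
    rw [hcover, Set.eq_univ_iff_forall]
    intro v
    by_cases hv : v ∈ S₀ ∪ T₀
    · exact Or.inl hv
    · exact Or.inr (by simpa using hv)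
  exact ⟨S, T, hST, huniv, hM.isTree_of_isAcyclic hST huniv hS hT⟩
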